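/- Let $R$ be an associative ring with identity (not necessarily commutative). Denote by $J(R)$ its Jacobson radical, by $N(R)$ its set of nilpotent elements and by $Z(R)$ its center. Suppose that $R$ is NJ-symmetric, i.e. for all $a,b,c\in R$, $abc\in N(R)$ implies $bac\in J(R)$; and that $R$ is semiperiodic, i.e. for each $a\in R\setminus(J(R)\cup Z(R))$ there are positive integers $p$ and $q$ of opposite parity such that $a^q-a^p\in N(R)$. Then the quotient ring $R/J(R)$ is commutative. -/

import Mathlib

/-- `R` is NJ-symmetric: if `a * b * c` is nilpotent then `b * a * c` lies in the
Jacobson radical `J(R)`. -/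
def IsNJSymmetric (R : Type*) [Ring R] : Prop :=
  ∀ a b c : R, IsNilpotent (a * b * c) → b * a * c ∈ Ring.jacobson R

/-- `R` is semiperiodic: for each `a` outside `J(R) ∪ Z(R)` there are positive integers `p`, `q`
of opposite parity such that `a ^ q - a ^ p` is nilpotent. -/
def IsSemiperiodic (R : Type*) [Ring R] : Prop :=
  ∀ a : R, a ∉ Ring.jacobson R → a ∉ Set.center R →
    ∃ p q : ℕ, 0 < p ∧ 0 < q ∧ Odd (p + q) ∧ IsNilpotent (a ^ q - a ^ p)

/-!
Put `S = R ⧸ J(R)`. NJ-symmetry is used only through `N(R) ⊆ J(R)` (take `a = c = 1`). Together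
with semiperiodicity this makes `S` reduced (`isReduced_quotient_jacobson`). In a reduced ring a
relation `s ^ p = s ^ q` sharpens to `s ^ (k + 1) = s` with `k = |q - p|`, so every noncentral
`s` in `S` satisfies such an equation with `k` odd.

If `S` has a noncentral element `a`, then comparing the periods of `a` and `-a` gives `2 a = 0`,
and the same for `a + 1` gives `2 = 0` in `S`. The equation `a ^ n = a` now says that `a` is fixed
by a power of the Frobenius. For central `z` both `a` and `a + z` are fixed by a common power,
hence so is `z`, and every element of `S` is potent (`mul_comm_of_noncentral_odd_period`).
Jacobson's theorem `mul_comm_of_forall_pow_eq_self` then yields that `S` is commutative.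

Jacobson's theorem reduces to division rings `D`, because a ring of potent elements has enough
maximal left ideals that are two-sided. If `a` is noncentral in `D`, then `K = 𝔽ₚ[a]` is a finite
field and right multiplication by `a` is a `K`-linear map killed by `∏ c ∈ K, (X - c)`. As it is
not left multiplication by `a`, it has an eigenvector `v` with eigenvalue `c ≠ a`
(`exists_mul_eq_map_mul`). From `v * a = c * v` it follows that `𝔽ₚ[a, v]` is finite
(`finite_adjoin_pair`), hence commutative by Wedderburn's little theorem, and this forces `c = a`.
-/

/-! ### Finite subalgebras of division rings -/

/-- If `b` normalises the subalgebra generated by `a`, in the sense that `b * a` lies in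
`F[a] * b`, then the product of the submodules `F[a]` and `F[b]` is a subalgebra,
so that `F[a, b]` is finite when `F` is finite and both generators are integral. -/
theorem finite_adjoin_pair {F A : Type*} [Field F] [Finite F] [Ring A] [Algebra F A] {a b c : A}
    (ha : IsIntegral F a) (hb : IsIntegral F b) (hc : c ∈ Algebra.adjoin F {a})
    (hab : b * a = c * b) : Finite (Algebra.adjoin F {a, b}) := by
  set K := Algebra.adjoin F {a} with hK
  set L := Algebra.adjoin F {b} with hL
  set P := Subalgebra.toSubmodule K * Subalgebra.toSubmodule L with hP
  have hbK : ∀ x ∈ K, ∃ y ∈ K, b * x = y * b := by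
    intro x hx
    induction hx using Algebra.adjoin_induction with
    | mem x hx => exact ⟨c, hc, by rw [Set.mem_singleton_iff.1 hx, hab]⟩
    | algebraMap r => exact ⟨_, K.algebraMap_mem r, (Algebra.commutes r b).symm⟩
    | add x y _ _ hx hy =>
      obtain ⟨u, hu, hu'⟩ := hx
      obtain ⟨v, hv, hv'⟩ := hy
      exact ⟨u + v, add_mem hu hv, by rw [mul_add, add_mul, hu', hv']⟩
    | mul x y _ _ hx hy =>
      obtain ⟨u, hu, hu'⟩ := hx
      obtain ⟨v, hv, hv'⟩ := hy
      exact ⟨u * v, mul_mem hu hv, by rw [← mul_assoc, hu', mul_assoc, hv', mul_assoc]⟩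
  have hbP : ∀ t ∈ P, b * t ∈ P := by
    intro t ht
    induction ht using Submodule.mul_induction_on' with
    | mem_mul_mem k hk l hl =>
      obtain ⟨y, hy, hy'⟩ := hbK k hk
      rw [← mul_assoc, hy', mul_assoc]
      exact Submodule.mul_mem_mul hy (L.mul_mem (Algebra.self_mem_adjoin_singleton F b) hl)
    | add x _ y _ hx hy => rw [mul_add]; exact add_mem hx hy
  have hLP : ∀ y ∈ L, ∀ t ∈ P, y * t ∈ P := by
    intro y hy
    induction hy using Algebra.adjoin_induction with
    | mem y hy => rw [Set.mem_singleton_iff.1 hy]; exact hbP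
    | algebraMap r => intro t ht; rw [← Algebra.smul_def]; exact P.smul_mem r ht
    | add y z _ _ hy hz => intro t ht; rw [add_mul]; exact add_mem (hy t ht) (hz t ht)
    | mul y z _ _ hy hz => intro t ht; rw [mul_assoc]; exact hy _ (hz t ht)
  have hKP : ∀ x ∈ K, ∀ t ∈ P, x * t ∈ P := by
    intro x hx t ht
    induction ht using Submodule.mul_induction_on' with
    | mem_mul_mem k hk l hl =>
      rw [← mul_assoc]
      exact Submodule.mul_mem_mul (K.mul_mem hx hk) hl
    | add x _ y _ hx hy => rw [mul_add]; exact add_mem hx hy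
  have hP1 : 1 ∈ P := by
    have := Submodule.mul_mem_mul (M := Subalgebra.toSubmodule K) (N := Subalgebra.toSubmodule L)
      K.one_mem L.one_mem
    rwa [one_mul] at this
  have hPP : ∀ x y, x ∈ P → y ∈ P → x * y ∈ P := by
    intro x y hx hy
    induction hx using Submodule.mul_induction_on' with
    | mem_mul_mem k hk l hl => rw [mul_assoc]; exact hKP k hk _ (hLP l hl y hy)
    | add u _ v _ hu hv => rw [add_mul]; exact add_mem hu hv
  have hle : Subalgebra.toSubmodule (Algebra.adjoin F {a, b}) ≤ P := by
    change Algebra.adjoin F {a, b} ≤ P.toSubalgebra hP1 hPP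
    refine Algebra.adjoin_le ?_
    rintro x (rfl | rfl)
    · exact (mul_one x ▸ hKP x (Algebra.self_mem_adjoin_singleton F x) 1 hP1 :)
    · exact (mul_one x ▸ hbP 1 hP1 :)
  have : Module.Finite F P := .of_fg (ha.fg_adjoin_singleton.mul hb.fg_adjoin_singleton)
  have : Finite P := Module.finite_of_finite F
  exact Finite.of_injective _ (Submodule.inclusion_injective hle)

/-! ### Right multiplication by an element of a finite subfield -/

open Polynomial in
/-- An endomorphism whose product of linear factors over `s` kills a nonzero vector has an
eigenvalue in `s`. -/
theorem exists_eigenvector_of_prod_eq_zero {K V : Type*} [Field K] [AddCommGroup V] [Module K V]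
    (f : Module.End K V) (s : Finset K) {w : V} (hw : w ≠ 0)
    (h : aeval f (∏ c ∈ s, (X - C c)) w = 0) : ∃ c ∈ s, ∃ v : V, v ≠ 0 ∧ f v = c • v := by
  classical
  induction s using Finset.induction_on with
  | empty => simp [hw] at h
  | insert c s hcs ih =>
    rw [Finset.prod_insert hcs, map_mul, Module.End.mul_apply] at h
    by_cases h0 : aeval f (∏ c ∈ s, (X - C c)) w = 0
    · obtain ⟨d, hd, hv⟩ := ih h0
      exact ⟨d, Finset.mem_insert_of_mem hd, hv⟩
    · refine ⟨c, Finset.mem_insert_self _ _, _, h0, ?_⟩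
      simpa [sub_eq_zero, Module.algebraMap_end_apply] using h

open Polynomial in
/-- If a noncentral element `a` of a ring lies in a finite subfield `K`, then `v * a = c * v` for
some `v ≠ 0` and some `c ≠ a` in `K`: right multiplication by `a` is `K`-linear for the left
`K`-structure and is killed by `X ^ |K| - X`, the product of the `X - c` for `c` in `K`. -/
theorem exists_mul_eq_map_mul {K D : Type*} [Field K] [Finite K] [Ring D] (φ : K →+* D) (α : K)
    {b : D} (hb : φ α * b ≠ b * φ α) :
    ∃ c : K, c ≠ α ∧ ∃ v : D, v ≠ 0 ∧ v * φ α = φ c * v := by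
  classical
  have := Fintype.ofFinite K
  let : Module K D := Module.compHom D φ
  have smul_def : ∀ (c : K) (v : D), c • v = φ c * v := fun _ _ ↦ rfl
  let f : Module.End K D :=
    { toFun := fun v ↦ v * φ α
      map_add' := fun u v ↦ add_mul u v _
      map_smul' := fun c v ↦ by simp [smul_def, mul_assoc] }
  have hf : ∀ v, f v = v * φ α := fun _ ↦ rfl
  have hfn : ∀ (n : ℕ) v, (f ^ n) v = v * φ α ^ n := by
    intro n
    induction n with
    | zero => simp
    | succ n ih => intro v; rw [pow_succ, Module.End.mul_apply, ih, hf, mul_assoc, ← pow_succ']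
  have hprod : ∏ c : K, (X - C c) = (X ^ Fintype.card K - X : K[X]) := by
    have hK : 1 < Fintype.card K := Fintype.one_lt_card
    have hroots := FiniteField.roots_X_pow_card_sub_X K
    have h := prod_multiset_X_sub_C_of_monic_of_roots_card_eq
      (p := (X ^ Fintype.card K - X : K[X]))
      (monic_X_pow_sub (degree_X_le.trans_lt (by exact_mod_cast hK)))
      (by rw [hroots, FiniteField.X_pow_card_sub_X_natDegree_eq K hK]; rfl)
    rwa [hroots] at h
  have hw : b * φ α - φ α * b ≠ 0 := sub_ne_zero.2 hb.symm
  obtain ⟨c, hc, v, hv, h⟩ := exists_eigenvector_of_prod_eq_zero f (Finset.univ.erase α) hw <| by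
    have h1 : b * φ α - φ α * b = aeval f (X - C α) b := by
      simp [hf, smul_def, Module.algebraMap_end_apply]
    rw [h1, ← Module.End.mul_apply, ← map_mul, Finset.prod_erase_mul _ _ (Finset.mem_univ α),
      hprod]
    rw [map_sub, map_pow, aeval_X, LinearMap.sub_apply, hfn, ← map_pow, FiniteField.pow_card, hf,
      sub_self]
  exact ⟨c, (Finset.mem_erase.1 hc).1, v, hv, h⟩

/-! ### Jacobson's theorem -/

theorem isIntegral_of_pow_eq_self {F A : Type*} [CommRing F] [Ring A] [Algebra F A] {x : A} {n : ℕ}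
    (hn : 1 < n) (hx : x ^ n = x) : IsIntegral F x :=
  ⟨Polynomial.X ^ n - Polynomial.X,
    Polynomial.monic_X_pow_sub (Polynomial.degree_X_le.trans_lt (by exact_mod_cast hn)),
    by simp [hx]⟩

/-- Jacobson's theorem for a division ring of prime characteristic. -/
theorem mul_comm_of_divisionRing_of_forall_pow_eq_self {D : Type*} [DivisionRing D] (p : ℕ)
    [Fact p.Prime] [CharP D p] (h : ∀ x : D, ∃ n, 1 < n ∧ x ^ n = x) (a b : D) :
    a * b = b * a := by
  let := ZMod.algebra D p
  by_contra hab
  have hint : ∀ x : D, IsIntegral (ZMod p) x := fun x ↦ by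
    obtain ⟨n, hn, hx⟩ := h x
    exact isIntegral_of_pow_eq_self hn hx
  have : Module.Finite (ZMod p) (Algebra.adjoin (ZMod p) {a}) :=
    .of_fg (hint a).fg_adjoin_singleton
  have : Finite (Algebra.adjoin (ZMod p) {a}) := Module.finite_of_finite (ZMod p)
  let : Field (Algebra.adjoin (ZMod p) {a}) := (Finite.isDomain_to_isField _).toField
  obtain ⟨c, hc, v, hv, hvc⟩ := exists_mul_eq_map_mul
    ((Algebra.adjoin (ZMod p) {a}).val : Algebra.adjoin (ZMod p) {a} →+* D)
    ⟨a, Algebra.self_mem_adjoin_singleton _ a⟩ hab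
  have hfin := finite_adjoin_pair (hint a) (hint v) c.2 hvc
  have hcomm := (Finite.isDomain_to_isField (Algebra.adjoin (ZMod p) {a, v})).mul_comm
    ⟨a, Algebra.subset_adjoin (by simp)⟩ ⟨v, Algebra.subset_adjoin (by simp)⟩
  have hav : a * v = v * a := congrArg Subtype.val hcomm
  refine hc (Subtype.ext (mul_right_cancel₀ hv ?_))
  exact (hav.trans hvc).symm

theorem IsIdempotentElem.commute_of_isReduced {S : Type*} [Ring S] [IsReduced S] {e : S}
    (he : IsIdempotentElem e) (r : S) : Commute e r := by
  have h₁ : (1 - e) * e = 0 := by rw [sub_mul, one_mul, he.eq, sub_self]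
  have h₂ : e * (1 - e) = 0 := by rw [mul_sub, mul_one, he.eq, sub_self]
  have h₃ : e * r * (1 - e) = 0 := by
    refine pow_eq_zero_iff two_ne_zero |>.1 ?_
    rw [sq, show e * r * (1 - e) * (e * r * (1 - e)) = e * r * ((1 - e) * e) * (r * (1 - e)) by
      simp only [mul_assoc], h₁, mul_zero, zero_mul]
  have h₄ : (1 - e) * r * e = 0 := by
    refine pow_eq_zero_iff two_ne_zero |>.1 ?_
    rw [sq, show (1 - e) * r * e * ((1 - e) * r * e) = (1 - e) * r * (e * (1 - e)) * (r * e) by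
      simp only [mul_assoc], h₂, mul_zero, zero_mul]
  rw [mul_sub, mul_one, sub_eq_zero] at h₃
  rw [sub_mul, sub_mul, one_mul, sub_eq_zero] at h₄
  exact h₃.trans h₄.symm

/-- **Jacobson's theorem** in prime characteristic. Every element is a multiple of a central
idempotent power of itself, so that left ideals are two-sided, the quotient by a maximal one is a
division ring, and a nonzero element survives in one of these quotients. -/
theorem mul_comm_of_forall_pow_eq_self {S : Type*} [Ring S] (p : ℕ) [Fact p.Prime] [CharP S p]
    (h : ∀ x : S, ∃ n, 1 < n ∧ x ^ n = x) (a b : S) : a * b = b * a := by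
  have hred : IsReduced S := by
    refine isReduced_iff_pow_one_lt 2 one_lt_two |>.2 fun x hx ↦ ?_
    obtain ⟨n, hn, hxn⟩ := h x
    rw [← hxn]
    exact pow_eq_zero_of_le hn hx
  have hidem : ∀ x : S, ∃ y, IsIdempotentElem (y * x) ∧ (y * x) * x = x := by
    intro x
    obtain ⟨n, hn, hxn⟩ := h x
    obtain ⟨m, rfl⟩ := Nat.exists_eq_add_of_le hn
    have hx : x ^ m * x * x = x := by
      rw [← pow_succ, ← pow_succ, add_assoc, add_comm m]
      exact hxn
    refine ⟨x ^ m, ?_, hx⟩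
    have hcomm := (Commute.pow_self x m).eq
    rw [IsIdempotentElem]
    nth_rewrite 2 [hcomm]
    rw [← mul_assoc, hx, ← hcomm]
  by_contra hab
  -- The commutator will survive in the quotient by a maximal left ideal containing `1 - y * x`.
  set x := a * b - b * a with hxdef
  have hx0 : x ≠ 0 := sub_ne_zero.2 hab
  obtain ⟨y, he, hyx⟩ := hidem x
  have hproper : Ideal.span {1 - y * x} ≠ ⊤ := by
    intro htop
    obtain ⟨r, hr⟩ := Ideal.mem_span_singleton'.1 ((Ideal.eq_top_iff_one _).1 htop)
    refine hx0 ?_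
    calc x = 1 * x := (one_mul x).symm
      _ = 0 := by rw [← hr, mul_assoc, sub_mul, hyx, one_mul, sub_self, mul_zero]
  obtain ⟨I, hI, hle⟩ := Ideal.exists_le_maximal _ hproper
  have : I.IsTwoSided := ⟨fun {u} r hu ↦ by
    obtain ⟨v, hv, hvu⟩ := hidem u
    have : u * r = (u * r * v) * u := by
      rw [mul_assoc, ← (hv.commute_of_isReduced _).eq, ← mul_assoc, hvu]
    rw [this]
    exact I.mul_mem_left _ hu⟩
  have : Nontrivial (S ⧸ I) := Ideal.Quotient.nontrivial_iff.2 hI.ne_top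
  have hunit : ∀ z : S ⧸ I, IsUnit z ∨ z = 0 := by
    intro z
    obtain ⟨u, rfl⟩ := Ideal.Quotient.mk_surjective z
    by_cases hu : u ∈ I
    · exact .inr (Ideal.Quotient.eq_zero_iff_mem.2 hu)
    obtain ⟨r, i, hi, hri⟩ := hI.exists_inv hu
    have hr : Ideal.Quotient.mk I r * Ideal.Quotient.mk I u = 1 := by
      rw [← map_mul, ← map_one (Ideal.Quotient.mk I), ← hri, map_add,
        Ideal.Quotient.eq_zero_iff_mem.2 hi, add_zero]
    obtain ⟨n, hn, hun⟩ := h u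
    refine .inl (IsUnit.of_pow_eq_one (n := n - 1) ?_ (Nat.sub_ne_zero_of_lt hn))
    rw [← one_mul (_ ^ _), ← hr, mul_assoc, mul_pow_sub_one (by omega), ← map_pow, hun]
  let : DivisionRing (S ⧸ I) := DivisionRing.ofIsUnitOrEqZero hunit
  let := ZMod.algebra S p
  have : CharP (S ⧸ I) p := charP_of_injective_ringHom
    (((Ideal.Quotient.mk I).comp (algebraMap (ZMod p) S)).injective) p
  have hcomm := mul_comm_of_divisionRing_of_forall_pow_eq_self (D := S ⧸ I) p (fun z ↦ by
    obtain ⟨u, rfl⟩ := Ideal.Quotient.mk_surjective z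
    obtain ⟨n, hn, hu⟩ := h u
    exact ⟨n, hn, by rw [← map_pow, hu]⟩) (Ideal.Quotient.mk I a) (Ideal.Quotient.mk I b)
  have hxI : x ∈ I := Ideal.Quotient.eq_zero_iff_mem.1 <| by
    rw [hxdef, map_sub, map_mul, map_mul, hcomm, sub_self]
  refine hI.ne_top ((Ideal.eq_top_iff_one I).2 ?_)
  have := I.add_mem (hle (Ideal.mem_span_singleton_self _)) (I.mul_mem_left y hxI)
  rwa [sub_add_cancel] at this

/-! ### Rings whose noncentral elements have odd period -/

/-- In a reduced ring of prime characteristic, periodicity means being fixed by some power of the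
Frobenius. -/
theorem exists_pow_char_pow_eq_self {S : Type*} [Ring S] [IsReduced S] (p : ℕ) [Fact p.Prime]
    [CharP S p] {x : S} {n : ℕ} (hn : 1 < n) (hx : x ^ n = x) : ∃ k, 0 < k ∧ x ^ p ^ k = x := by
  have hfin : (Set.range fun i : ℕ ↦ x ^ i).Finite := by
    refine ((Set.finite_Iio n).image fun i ↦ x ^ i).subset ?_
    rintro _ ⟨i, rfl⟩
    induction i using Nat.strong_induction_on with
    | _ i ih =>
      obtain hi | hi := lt_or_ge i n
      · exact ⟨i, hi, rfl⟩
      · obtain ⟨j, rfl⟩ := Nat.exists_eq_add_of_le hi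
        have : x ^ (n + j) = x ^ (1 + j) := by rw [pow_add, hx, pow_add, pow_one]
        change x ^ (n + j) ∈ _
        rw [this]
        exact ih (1 + j) (by omega)
  obtain ⟨i, j, hij, h⟩ : ∃ i j : ℕ, i < j ∧ x ^ p ^ i = x ^ p ^ j := by
    have := hfin.to_subtype
    obtain ⟨i, j, hij, h⟩ := Finite.exists_ne_map_eq_of_infinite
      fun i : ℕ ↦ (⟨x ^ p ^ i, p ^ i, rfl⟩ : Set.range fun i : ℕ ↦ x ^ i)
    have h := congrArg Subtype.val h
    obtain hlt | hlt := hij.lt_or_gt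
    exacts [⟨i, j, hlt, h⟩, ⟨j, i, hlt, h.symm⟩]
  obtain ⟨k, rfl⟩ := Nat.exists_eq_add_of_lt hij
  refine ⟨k + 1, k.succ_pos, ?_⟩
  -- The Frobenius is injective on the commutative subring generated by `x`, by reducedness.
  have h0 : (x ^ p ^ (k + 1) - x) ^ p ^ i = 0 := by
    rw [sub_pow_char_pow_of_commute (p := p) _ (Commute.pow_self x _), ← pow_mul, ← pow_add, h,
      sub_eq_zero]
    congr 2
    omega
  exact sub_eq_zero.1 (pow_eq_zero_iff (pow_pos (Fact.out : p.Prime).pos i).ne' |>.1 h0)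

theorem pow_mul_add_one_eq_self {M : Type*} [Monoid M] {x : M} {k : ℕ} (hx : x ^ (k + 1) = x)
    (m : ℕ) : x ^ (k * m + 1) = x := by
  induction m with
  | zero => simp
  | succ m ih => rw [mul_add, mul_one, add_right_comm, pow_add, ih, ← pow_succ', hx]

/-- If both `x` and `-x` have odd period, then comparing `x ^ (k * l + 1)` with
`(-x) ^ (k * l + 1)` gives `x = -x`. -/
theorem add_self_eq_zero_of_odd_period {S : Type*} [Ring S] {x : S} {k l : ℕ} (hk : Odd k)
    (hl : Odd l) (hx : x ^ (k + 1) = x) (hx' : (-x) ^ (l + 1) = -x) : x + x = 0 := by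
  have h₁ := pow_mul_add_one_eq_self hx l
  have h₂ := pow_mul_add_one_eq_self hx' k
  rw [mul_comm, (hk.mul hl).add_one.neg_pow, h₁] at h₂
  nth_rewrite 1 [h₂]
  exact neg_add_cancel x

/-- With `x` also `-x` and `x + 1` are noncentral; this forces characteristic two. For central `z`, the Frobenius powers fixing `x` and `x + z` have a common iterate, which
fixes `z` as well, and Jacobson's theorem applies. -/
theorem mul_comm_of_noncentral_odd_period {S : Type*} [Ring S] [IsReduced S]
    (h : ∀ x : S, x ∉ Set.center S → ∃ k, Odd k ∧ x ^ (k + 1) = x) (a b : S) :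
    a * b = b * a := by
  by_contra hab
  have haZ : a ∉ Subring.center S := fun ha ↦ hab (Subring.mem_center_iff.1 ha b).symm
  have htwo : ∀ x : S, x ∉ Subring.center S → x + x = 0 := by
    intro x hx
    obtain ⟨k, hk, hxk⟩ := h x hx
    obtain ⟨l, hl, hxl⟩ := h (-x) fun hn ↦ hx (neg_mem_iff.1 hn)
    exact add_self_eq_zero_of_odd_period hk hl hxk hxl
  have htranslate : ∀ z ∈ Subring.center S, a + z ∉ Subring.center S := fun z hz hn ↦
    haZ ((add_mem_cancel_right hz).1 hn)
  have hchar : (2 : S) = 0 := by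
    have h₁ := htwo a haZ
    have h₂ := htwo (a + 1) (htranslate 1 (one_mem _))
    rw [add_add_add_comm, h₁, zero_add, one_add_one_eq_two] at h₂
    exact h₂
  have : Nontrivial S := ⟨_, _, hab⟩
  have : CharP S 2 := CharTwo.of_one_ne_zero_of_two_eq_zero one_ne_zero hchar
  have hfrob : ∀ x : S, x ∉ Subring.center S → ∃ k, 0 < k ∧ x ^ 2 ^ k = x := by
    intro x hx
    obtain ⟨k, hk, hxk⟩ := h x hx
    exact exists_pow_char_pow_eq_self 2 (Nat.lt_add_of_pos_left hk.pos) hxk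
  have hiter : ∀ (x : S) (k l : ℕ), x ^ 2 ^ k = x → x ^ 2 ^ (k * l) = x := by
    intro x k l hx
    induction l with
    | zero => simp
    | succ l ih => rw [mul_add, mul_one, pow_add, pow_mul, ih, hx]
  refine hab (mul_comm_of_forall_pow_eq_self 2 (fun z ↦ ?_) a b)
  by_cases hz : z ∈ Subring.center S
  · obtain ⟨k, hk, hak⟩ := hfrob a haZ
    obtain ⟨l, hl, hal⟩ := hfrob (a + z) (htranslate z hz)
    refine ⟨2 ^ (k * l), Nat.one_lt_two_pow (mul_pos hk hl).ne', ?_⟩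
    have h₁ := hiter (a + z) l k hal
    rw [mul_comm l k, add_pow_char_pow_of_commute (p := 2) _ (Subring.mem_center_iff.1 hz a :),
      hiter a k l hak] at h₁
    exact add_left_cancel h₁
  · obtain ⟨k, hk, hxk⟩ := h z hz
    exact ⟨k + 1, Nat.lt_add_of_pos_left hk.pos, hxk⟩

/-! ### The quotient by the Jacobson radical -/

theorem IsNJSymmetric.mem_jacobson_of_isNilpotent {R : Type*} [Ring R] (h : IsNJSymmetric R)
    {x : R} (hx : IsNilpotent x) : x ∈ Ring.jacobson R := by
  simpa using h 1 x 1 (by simpa using hx)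

/-- Elements of `1 + J(R)` are left cancellable, and so are their powers. -/
theorem Ring.eq_zero_of_pow_mul_eq_zero_of_one_sub_mem_jacobson {R : Type*} [Ring R] {u x : R}
    (hu : 1 - u ∈ Ring.jacobson R) {m : ℕ} (h : u ^ m * x = 0) : x = 0 := by
  rw [← Ideal.jacobson_bot, Ideal.mem_jacobson_iff] at hu
  obtain ⟨z, hz⟩ := hu (-1)
  have hzu : z * u = 1 := by
    rw [Ideal.mem_bot] at hz
    rw [← sub_eq_zero, ← hz]
    noncomm_ring
  induction m with
  | zero => simpa using h
  | succ m ih =>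
    refine ih ?_
    rw [← one_mul (u ^ m * x), ← hzu, mul_assoc, ← mul_assoc u, ← pow_succ', h, mul_zero]

theorem Ring.mem_jacobson_of_mem_center_of_pow_mem {R : Type*} [Ring R] {x : R}
    (hx : x ∈ Set.center R) {n : ℕ} (hn : x ^ n ∈ Ring.jacobson R) : x ∈ Ring.jacobson R := by
  rw [Ring.jacobson_eq_sInf_isMaximal, Submodule.mem_sInf]
  intro I hI
  have hI : Ideal.IsMaximal I := hI
  have hnI : x ^ n ∈ I := Ring.jacobson_le_of_isMaximal I hn
  by_contra hxI
  obtain ⟨r, i, hi, hri⟩ := hI.exists_inv hxI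
  clear hn
  induction n with
  | zero => exact hI.ne_top ((Ideal.eq_top_iff_one I).2 (by simpa using hnI))
  | succ n ih =>
    refine ih ?_
    have hcomm : x ^ n * r = r * x ^ n :=
      (Subring.mem_center_iff.1 (pow_mem (show x ∈ Subring.center R from hx) n) r).symm
    rw [← mul_one (x ^ n), ← hri, mul_add, ← mul_assoc, hcomm, mul_assoc, ← pow_succ]
    exact Ideal.add_mem I (Ideal.mul_mem_left I _ hnI) (Ideal.mul_mem_left I _ hi)

/-- The relation defining semiperiodicity, with the exponents ordered. -/
theorem IsSemiperiodic.exists_isNilpotent {R : Type*} [Ring R] (h : IsSemiperiodic R) {x : R}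
    (hxJ : x ∉ Ring.jacobson R) (hxZ : x ∉ Set.center R) :
    ∃ p k : ℕ, 0 < p ∧ Odd k ∧ IsNilpotent (x ^ p * (x ^ k - 1)) := by
  have key : ∀ p q : ℕ, p < q → Odd (p + q) → ∃ k, Odd k ∧ x ^ p * (x ^ k - 1) = x ^ q - x ^ p := by
    intro p q hlt hodd
    obtain ⟨k, rfl⟩ := Nat.exists_eq_add_of_le hlt.le
    refine ⟨k, ?_, by rw [mul_sub, mul_one, pow_add]⟩
    rwa [← add_assoc, Nat.odd_add', iff_true_right (Even.add_self p)] at hodd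
  obtain ⟨p, q, hp, hq, hodd, hnil⟩ := h x hxJ hxZ
  obtain hlt | rfl | hlt := lt_trichotomy p q
  · obtain ⟨k, hk, he⟩ := key p q hlt hodd
    exact ⟨p, k, hp, hk, he ▸ hnil⟩
  · exact absurd hodd (Nat.not_odd_iff_even.2 (Even.add_self p))
  · obtain ⟨k, hk, he⟩ := key q p hlt (add_comm p q ▸ hodd)
    exact ⟨q, k, hq, hk, by rw [he, ← neg_sub]; exact hnil.neg⟩

/-- Let `x ^ n ∈ J(R)`. A central `x` then lies in every maximal left ideal. A noncentral one
satisfies a relation `x ^ p * (x ^ k - 1) ∈ N(R)`; as `x ^ k - 1` divides the unit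
`1 - x ^ (k * n)`, `x` is nilpotent, and `N(R) ⊆ J(R)`. -/
theorem isReduced_quotient_jacobson {R : Type*} [Ring R] (hNJ : IsNJSymmetric R)
    (hsp : IsSemiperiodic R) : IsReduced (R ⧸ Ring.jacobson R) := by
  refine ⟨fun s ⟨n, hn⟩ ↦ ?_⟩
  obtain ⟨x, rfl⟩ := Ideal.Quotient.mk_surjective s
  rw [← map_pow, Ideal.Quotient.eq_zero_iff_mem] at hn
  rw [Ideal.Quotient.eq_zero_iff_mem]
  by_contra hxJ
  by_cases hxZ : x ∈ Set.center R
  · exact hxJ (Ring.mem_jacobson_of_mem_center_of_pow_mem hxZ hn)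
  obtain ⟨p, k, -, hk, hnil⟩ := hsp.exists_isNilpotent hxJ hxZ
  set g := ∑ i ∈ Finset.range n, (x ^ k) ^ i with hg
  have hxg : Commute x g := .sum_right _ _ _ fun i _ ↦
    ((Commute.refl x).pow_right _).pow_right _
  have hu : (1 - x ^ k) * g = 1 - x ^ (k * n) := by
    rw [hg, mul_neg_geom_sum, ← pow_mul]
  obtain ⟨m, hm⟩ : IsNilpotent (x ^ p * (1 - x ^ (k * n))) := by
    rw [← hu, ← mul_assoc, ← neg_sub, mul_neg, neg_mul]
    refine (Commute.isNilpotent_mul_right ?_ hnil).neg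
    exact (hxg.pow_left p).mul_left ((hxg.pow_left _).sub_left (.one_left g))
  have hcomm : Commute (x ^ p) (1 - x ^ (k * n)) :=
    (Commute.one_right _).sub_right (Commute.pow_pow_self x _ _)
  rw [hcomm.mul_pow, (hcomm.pow_pow m m).eq, ← pow_mul] at hm
  refine hxJ (hNJ.mem_jacobson_of_isNilpotent
    ⟨_, Ring.eq_zero_of_pow_mul_eq_zero_of_one_sub_mem_jacobson ?_ hm⟩)
  obtain ⟨l, rfl⟩ := Nat.exists_eq_add_of_lt hk.pos
  rw [sub_sub_cancel, mul_comm, pow_mul, pow_succ]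
  exact Ideal.mul_mem_left _ _ hn

theorem mainTheorem5 {R : Type*} [Ring R] (hNJ : IsNJSymmetric R) (hsp : IsSemiperiodic R) :
    ∀ x y : R ⧸ Ring.jacobson R, x * y = y * x := by
  have := isReduced_quotient_jacobson hNJ hsp
  refine mul_comm_of_noncentral_odd_period fun s hs ↦ ?_
  obtain ⟨x, rfl⟩ := Ideal.Quotient.mk_surjective s
  have hxJ : x ∉ Ring.jacobson R := fun hx ↦ hs <| by
    rw [Ideal.Quotient.eq_zero_iff_mem.2 hx]
    exact Set.zero_mem_center
  have hxZ : x ∉ Set.center R := fun hx ↦ hs <| by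
    refine Subring.mem_center_iff.2 fun t ↦ ?_
    obtain ⟨y, rfl⟩ := Ideal.Quotient.mk_surjective t
    rw [← map_mul, ← map_mul, Subring.mem_center_iff.1 hx y]
  obtain ⟨p, k, hp, hk, hnil⟩ := hsp.exists_isNilpotent hxJ hxZ
  refine ⟨k, hk, ?_⟩
  set s := Ideal.Quotient.mk (Ring.jacobson R) x
  have h₀ : s ^ p * (s ^ k - 1) = 0 := by
    have := Ideal.Quotient.eq_zero_iff_mem.2 (hNJ.mem_jacobson_of_isNilpotent hnil)
    simpa only [map_mul, map_sub, map_pow, map_one] using this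
  have hcomm : Commute s (s ^ k - 1) := ((Commute.refl s).pow_right k).sub_right (.one_right s)
  -- Reducedness cancels all but one of the factors `s` in `s ^ p * (s ^ k - 1) = 0`.
  have h₁ : (s * (s ^ k - 1)) ^ p = 0 := by
    rw [hcomm.mul_pow, ← mul_pow_sub_one hp.ne' (s ^ k - 1), ← mul_assoc, h₀, zero_mul]
  have h₂ := (pow_eq_zero_iff hp.ne').1 h₁
  rwa [mul_sub, mul_one, sub_eq_zero, ← pow_succ'] at h₂
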